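/- Let $Q$ be a triangle $\triangle ABC$ in the Euclidean plane with angle $\pi/n$ at $A$ and angle $m\pi/n$ at $B$, where $n$ is even and $m$ is a positive integer with $m<n-1$. Then there is no billiard trajectory in $Q$ from $A$ coming back to $A$. Here a billiard trajectory in $Q$ from $P$ to $R$ is a unit speed path in $Q$, of positive length, that starts at $P$, ends at $R$, and consists of finitely many straight segments such that at each point where two consecutive segments meet the path is at a point of an edge of $Q$ which is not a vertex, and its velocity is reflected in that edge. (Thus a trajectory may start or end at a vertex, but it does not continue through a vertex.) -/

import Mathlib

/-- The Euclidean plane. -/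
abbrev Plane : Type := EuclideanSpace ℝ (Fin 2)

namespace TriangleBilliard

/-- The billiard table: the closed triangular region with the given vertices. -/
def table (Q : Affine.Triangle ℝ Plane) : Set Plane :=
  convexHull ℝ (Set.range Q.points)

/-- The `i`-th edge of the triangle, opposite to vertex `i`, without its two end points
(indices are taken modulo `3`). -/
def openEdge (Q : Affine.Triangle ℝ Plane) (i : Fin 3) : Set Plane :=
  openSegment ℝ (Q.points (i + 1)) (Q.points (i + 2))

/-- The linear part of the reflection of the plane in the line carrying the `i`-th edge. -/
noncomputable def edgeReflection (Q : Affine.Triangle ℝ Plane) (i : Fin 3) :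
    Plane ≃ₗᵢ[ℝ] Plane :=
  (Submodule.span ℝ {Q.points (i + 2) - Q.points (i + 1)}).reflection

end TriangleBilliard

/-- A (unit speed) billiard trajectory of positive length in the triangle `Q`, from the point `P`
to the point `R`. There are times `0 = t₀ < t₁ < ⋯ < t_{k+1}`, where `k` is the number of bounces.
On `[t_i, t_{i+1}]` the billiard ball moves inside `Q` along a straight line with unit velocity
`v_i`; at each intermediate time `t_{i+1}`, `i < k`, it is at a point in the relative interior of
some edge (so not at a vertex), and the velocity is reflected in that edge.
The points `P` and `R` may be vertices; a trajectory does not continue through a vertex.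
The values of `time`, `dir`, `wall` at indices beyond those just described, and of `pos` outside
the time interval `[0, t_{k+1}]`, are irrelevant. -/
structure BilliardTrajectory (Q : Affine.Triangle ℝ Plane) (P R : Plane) where
  /-- The number `k` of bounces. -/
  bounces : ℕ
  /-- The times `t₀, …, t_{k+1}`. -/
  time : ℕ → ℝ
  /-- The position of the billiard ball as a function of time. -/
  pos : ℝ → Plane
  /-- The velocity `v_i` on `[t_i, t_{i+1}]`, for `i = 0, …, k`. -/
  dir : ℕ → Plane
  /-- The edge that is hit at time `t_{i+1}`, for `i < k`. -/
  wall : ℕ → Fin 3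
  time_zero : time 0 = 0
  time_lt : ∀ i ≤ bounces, time i < time (i + 1)
  norm_dir : ∀ i ≤ bounces, ‖dir i‖ = 1
  pos_eq : ∀ i ≤ bounces, ∀ t ∈ Set.Icc (time i) (time (i + 1)),
    pos t = pos (time i) + (t - time i) • dir i
  pos_mem : ∀ t ∈ Set.Icc 0 (time (bounces + 1)), pos t ∈ TriangleBilliard.table Q
  hit : ∀ i < bounces, pos (time (i + 1)) ∈ TriangleBilliard.openEdge Q (wall i)
  reflect : ∀ i < bounces, dir (i + 1) = TriangleBilliard.edgeReflection Q (wall i) (dir i)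
  pos_start : pos 0 = P
  pos_end : pos (time (bounces + 1)) = R

/-! Place `A` at the corner of a sector of angle `π / n`. All sides then have real `n`-th powers, so
each bounce conjugates the `n`-th power of the velocity (`dir_pow_eq`), whose real part is therefore
constant. The initial velocity and the reversed final one both point into the sector; there, since
cosine is injective on `[0, π]`, a unit vector is determined by the real part of its `n`-th power.
So the ball comes back along its initial direction, and by `eq_reverse` the path is its own
reversal. Its middle is either a segment whose velocity equals its own negative, or a bounce that
negates the velocity. As `n` is even, the latter makes the `n`-th power real, but the initial
velocity is strictly inside the sector, so its `n`-th power is not real. -/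

open scoped ComplexConjugate

/-! ### Arguments and `n`-th powers in a sector -/

/-- A nonnegative combination of `1` and `exp (α * I)` has its argument in `[0, α]`. -/
theorem Complex.arg_mem_Icc_of_sector {α a s : ℝ} (hα : 0 < α) (hα' : α < Real.pi)
    (ha : 0 ≤ a) (hs : 0 ≤ s) (h : (a : ℂ) + s * Complex.exp (α * Complex.I) ≠ 0) :
    Complex.arg (a + s * Complex.exp (α * Complex.I)) ∈ Set.Icc 0 α := by
  have hsin : 0 < Real.sin α := Real.sin_pos_of_pos_of_lt_pi hα hα'
  set z : ℂ := a + s * Complex.exp (α * Complex.I) with hz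
  have hre : z.re = a + s * Real.cos α := by
    simp [hz, Complex.exp_ofReal_mul_I_re]
  have him : z.im = s * Real.sin α := by
    simp [hz, Complex.exp_ofReal_mul_I_im]
  have h0 : 0 ≤ z.arg := Complex.arg_nonneg_iff.2 (by rw [him]; positivity)
  refine ⟨h0, ?_⟩
  by_contra! hlt
  have hneg : Real.sin (α - z.arg) < 0 := by
    refine Real.sin_neg_of_neg_of_neg_pi_lt (by linarith) ?_
    linarith [Complex.arg_le_pi z]
  have hnorm : 0 < ‖z‖ := norm_pos_iff.2 h
  -- Both sides are the signed distance of `z` from the line of argument `α`; beyond that ray it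
  -- would be negative.
  have key : ‖z‖ * Real.sin (α - z.arg) = a * Real.sin α := by
    rw [Real.sin_sub]
    have e1 := Complex.norm_mul_cos_arg z
    have e2 := Complex.norm_mul_sin_arg z
    rw [hre] at e1
    rw [him] at e2
    linear_combination Real.sin α * e1 - Real.cos α * e2
  have : 0 ≤ a * Real.sin α := by positivity
  nlinarith

/-- A positive combination of `1` and `exp (α * I)` has its argument in `(0, α)`. -/
theorem Complex.arg_mem_Ioo_of_sector {α a s : ℝ} (hα : 0 < α) (hα' : α < Real.pi)
    (ha : 0 < a) (hs : 0 < s) :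
    (a : ℂ) + s * Complex.exp (α * Complex.I) ≠ 0 ∧
    Complex.arg (a + s * Complex.exp (α * Complex.I)) ∈ Set.Ioo 0 α := by
  have hsin : 0 < Real.sin α := Real.sin_pos_of_pos_of_lt_pi hα hα'
  have hne : (a : ℂ) + s * Complex.exp (α * Complex.I) ≠ 0 := by
    intro h
    have := congrArg Complex.im h
    simp [Complex.exp_ofReal_mul_I_im, hs.ne', hsin.ne'] at this
  obtain ⟨h0, h1⟩ := Complex.arg_mem_Icc_of_sector hα hα' ha.le hs.le hne
  set z : ℂ := a + s * Complex.exp (α * Complex.I) with hz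
  have hre : z.re = a + s * Real.cos α := by
    simp [hz, Complex.exp_ofReal_mul_I_re]
  have him : z.im = s * Real.sin α := by
    simp [hz, Complex.exp_ofReal_mul_I_im]
  have e1 := Complex.norm_mul_cos_arg z
  have e2 := Complex.norm_mul_sin_arg z
  rw [hre] at e1
  rw [him] at e2
  refine ⟨hne, lt_of_le_of_ne h0 fun h => ?_, lt_of_le_of_ne h1 fun h => ?_⟩
  · rw [← h, Real.sin_zero, mul_zero] at e2
    exact (mul_pos hs hsin).ne e2
  · rw [h] at e1 e2
    have : a * Real.sin α = 0 := by linear_combination Real.cos α * e2 - Real.sin α * e1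
    exact (mul_pos ha hsin).ne' this

theorem Complex.pow_eq_norm_pow_mul_exp (z : ℂ) (n : ℕ) :
    z ^ n = (‖z‖ ^ n : ℝ) * Complex.exp ((n * z.arg : ℝ) * Complex.I) := by
  conv_lhs => rw [← Complex.norm_mul_exp_arg_mul_I z, mul_pow, ← Complex.exp_nat_mul]
  push_cast
  ring_nf

/-- If the unoriented angle of two complex numbers is a multiple of `π / n`, the `n`-th power of
their quotient is real. -/
theorem Complex.conj_div_pow_of_angle {x y : ℂ} (hx : x ≠ 0) (hy : y ≠ 0) {n k : ℕ} (hn : n ≠ 0)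
    (h : InnerProductGeometry.angle x y = k * Real.pi / n) :
    conj ((x / y) ^ n) = (x / y) ^ n := by
  rw [Complex.angle_eq_abs_arg hx hy] at h
  have hn' : (n : ℝ) ≠ 0 := Nat.cast_ne_zero.2 hn
  rw [Complex.conj_eq_iff_im, Complex.pow_eq_norm_pow_mul_exp, Complex.im_ofReal_mul,
    Complex.exp_ofReal_mul_I_im]
  refine mul_eq_zero_of_right _ ?_
  have hk : (n : ℝ) * |(x / y).arg| = k * Real.pi := by rw [h]; field_simp
  rcases abs_choice (x / y).arg with h' | h' <;> rw [h'] at hk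
  · rw [hk, Real.sin_nat_mul_pi]
  · rw [mul_neg] at hk
    rw [← neg_eq_zero, ← Real.sin_neg, hk, Real.sin_nat_mul_pi]

theorem Complex.conj_pow_of_angle {x y : ℂ} (hx : x ≠ 0) (hy : y ≠ 0) {n k : ℕ} (hn : n ≠ 0)
    (h : InnerProductGeometry.angle x y = k * Real.pi / n) (hxn : conj (x ^ n) = x ^ n) :
    conj (y ^ n) = y ^ n := by
  have h1 := Complex.conj_div_pow_of_angle hx hy hn h
  have h2 : y ^ n = x ^ n / (x / y) ^ n := by rw [← div_pow]; congr 1; field_simp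
  rw [h2, map_div₀, h1, hxn]

/-! ### Complex coordinates and reflections -/

/-- Isometric complex coordinates in which two given vectors have arguments `0` and their
unoriented angle. -/
theorem exists_isometry_complex_of_angle {u w : Plane} (hu : u ≠ 0) (hw : w ≠ 0) :
    ∃ L : Plane ≃ₗᵢ[ℝ] ℂ, L u = ‖u‖ ∧
      L w = ‖w‖ * Complex.exp (InnerProductGeometry.angle u w * Complex.I) := by
  obtain ⟨L, hL⟩ : ∃ L : Plane ≃ₗᵢ[ℝ] ℂ, L u = ‖u‖ := by
    let L₀ : Plane ≃ₗᵢ[ℝ] ℂ := Complex.orthonormalBasisOneI.repr.symm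
    have h0 : ‖L₀ u‖ = ‖u‖ := L₀.norm_map u
    refine ⟨L₀.trans (rotation (Circle.exp (-(L₀ u).arg))), ?_⟩
    rw [LinearIsometryEquiv.trans_apply, rotation_apply, Circle.coe_exp, ← h0]
    nth_rw 2 [← Complex.norm_mul_exp_arg_mul_I (L₀ u)]
    rw [mul_left_comm, ← Complex.exp_add]
    simp
  have hang : InnerProductGeometry.angle u w = |(L w).arg| := by
    have h1 : InnerProductGeometry.angle (L w) (L u) = InnerProductGeometry.angle w u :=
      L.toLinearIsometry.angle_map w u
    rw [InnerProductGeometry.angle_comm, ← h1,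
      Complex.angle_eq_abs_arg (by simpa using hw) (by simpa using hu), hL, div_eq_mul_inv,
      ← Complex.ofReal_inv, Complex.arg_mul_real (inv_pos.2 (norm_pos_iff.2 hu))]
  have hnw : ‖L w‖ = ‖w‖ := L.norm_map w
  rcases le_total 0 (L w).arg with h | h
  · refine ⟨L, hL, ?_⟩
    rw [hang, abs_of_nonneg h, ← hnw, Complex.norm_mul_exp_arg_mul_I]
  -- Conjugation fixes the real image of `u` and flips the sign of the argument of `L w`.
  · refine ⟨L.trans Complex.conjLIE, ?_, ?_⟩
    · simp [hL]
    · rw [hang, abs_of_nonpos h, ← hnw]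
      conv_lhs => rw [LinearIsometryEquiv.trans_apply, ← Complex.norm_mul_exp_arg_mul_I (L w)]
      simp [← Complex.exp_conj]

/-- In isometric complex coordinates, reflection in the line spanned by `e` is
`z ↦ ε / conj ε * conj z`, where `ε` is the coordinate of `e`. -/
theorem isometry_complex_reflection (L : Plane ≃ₗᵢ[ℝ] ℂ) {e : Plane} (he : e ≠ 0) (v : Plane) :
    L ((Submodule.span ℝ {e}).reflection v) = L e / conj (L e) * conj (L v) := by
  have hε : L e ≠ 0 := by simpa using he
  have hε' : conj (L e) ≠ 0 := by simpa using hε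
  rw [Submodule.reflection_singleton_apply]
  simp only [map_sub, map_nsmul, map_smul, inner_map_complex L, ← L.norm_map e]
  generalize L e = ε at *
  generalize L v = z at *
  have h1 : ((‖ε‖ : ℝ) : ℂ) ^ 2 = ε * conj ε := (Complex.mul_conj' ε).symm
  have h2 : (((z * conj ε).re : ℝ) : ℂ) = (z * conj ε + conj z * ε) / 2 := by
    rw [Complex.re_eq_add_conj]; simp
  simp only [Complex.real_smul, nsmul_eq_mul]
  push_cast
  simp only [RCLike.ofReal_real_eq_id, id]
  rw [h1, h2]
  field_simp
  ring

/-- If `(L e) ^ n` is real, reflection in the line spanned by `e` conjugates `n`-th powers. -/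
theorem isometry_complex_reflection_pow (L : Plane ≃ₗᵢ[ℝ] ℂ) {e : Plane} (he : e ≠ 0) {n : ℕ}
    (hn : conj ((L e) ^ n) = (L e) ^ n) (v : Plane) :
    (L ((Submodule.span ℝ {e}).reflection v)) ^ n = conj ((L v) ^ n) := by
  have hε : L e ≠ 0 := by simpa using he
  rw [isometry_complex_reflection L he, mul_pow, div_pow, ← map_pow (starRingEnd ℂ),
    ← map_pow (starRingEnd ℂ), hn, div_self (pow_ne_zero _ hε), one_mul]

/-! ### Barycentric coordinates on the table -/

namespace TriangleBilliard

variable (Q : Affine.Triangle ℝ Plane)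

/-- The vertices of a triangle, as an affine basis of the plane. -/
noncomputable def vertexBasis : AffineBasis (Fin 3) ℝ Plane :=
  ⟨Q.points, Q.independent, by
    rw [Q.independent.affineSpan_eq_top_iff_card_eq_finrank_add_one]; simp⟩

/-- The `i`-th barycentric coordinate. It vanishes on the `i`-th edge. -/
noncomputable def bary (i : Fin 3) : Plane →ᵃ[ℝ] ℝ := (vertexBasis Q).coord i

/-- The linear part of the `i`-th barycentric coordinate. -/
noncomputable def slope (i : Fin 3) : Plane →ₗ[ℝ] ℝ := (bary Q i).linear

theorem bary_add_smul (i : Fin 3) (p d : Plane) (t : ℝ) :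
    bary Q i (p + t • d) = bary Q i p + t * slope Q i d := by
  have := (bary Q i).map_vadd p (t • d)
  rw [vadd_eq_add, vadd_eq_add, map_smul, smul_eq_mul] at this
  rw [add_comm p, this, add_comm]
  rfl

theorem bary_points (i j : Fin 3) : bary Q i (Q.points j) = if i = j then 1 else 0 :=
  (vertexBasis Q).coord_apply i j

theorem bary_nonneg {p : Plane} (hp : p ∈ table Q) (i : Fin 3) : 0 ≤ bary Q i p := by
  have h := (vertexBasis Q).convexHull_eq_nonneg_coord
  have hp' : p ∈ convexHull ℝ (Set.range (vertexBasis Q)) := hp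
  rw [h] at hp'
  exact hp' i

/-- Since end points are excluded, a bounce point determines its wall. -/
theorem bary_of_mem_openEdge {p : Plane} {j : Fin 3} (hp : p ∈ openEdge Q j) (i : Fin 3) :
    bary Q i p = 0 ↔ i = j := by
  obtain ⟨a, b, ha, hb, hab, rfl⟩ := hp
  have h : a • Q.points (j + 1) + b • Q.points (j + 2)
      = AffineMap.lineMap (Q.points (j + 1)) (Q.points (j + 2)) b := by
    rw [AffineMap.lineMap_apply_module, ← hab]; simp
  rw [h, AffineMap.apply_lineMap, bary_points, bary_points, AffineMap.lineMap_apply_module]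
  have hb1 : 1 - b = a := by linarith
  rw [hb1]
  fin_cases i <;> fin_cases j <;> simp [ha.ne', hb.ne']

theorem bary_wall {p : Plane} {j : Fin 3} (hp : p ∈ openEdge Q j) : bary Q j p = 0 :=
  (bary_of_mem_openEdge Q hp j).2 rfl

/-- Decomposition of a vector along the two sides at vertex `i`. -/
theorem eq_slope_smul_add (i : Fin 3) (d : Plane) :
    d = slope Q (i + 1) d • (Q.points (i + 1) - Q.points i)
      + slope Q (i + 2) d • (Q.points (i + 2) - Q.points i) := by
  have hs (j : Fin 3) : slope Q j d = bary Q j d - bary Q j 0 := by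
    have := bary_add_smul Q j 0 d 1
    simp at this
    linarith
  have h1 : ∑ j, bary Q j d = 1 := (vertexBasis Q).sum_coord_apply_eq_one d
  have h2 : ∑ j, bary Q j 0 = 1 := (vertexBasis Q).sum_coord_apply_eq_one 0
  have h3 : ∑ j, bary Q j d • Q.points j = d := (vertexBasis Q).linear_combination_coord_eq_self d
  have h4 : ∑ j, bary Q j 0 • Q.points j = 0 := (vertexBasis Q).linear_combination_coord_eq_self 0
  have e1 : ∑ j, slope Q j d = 0 := by simp [hs, h1, h2]
  have e2 : ∑ j, slope Q j d • Q.points j = d := by simp [hs, sub_smul, h3, h4]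
  -- The slopes sum to zero, so the origin of the vertex vectors can be moved to vertex `i`.
  have e3 : ∑ j, slope Q j d • (Q.points j - Q.points i) = d := by
    simp only [smul_sub, Finset.sum_sub_distrib, e2, ← Finset.sum_smul, e1]
    simp
  conv_lhs => rw [← e3, Fin.sum_univ_three]
  fin_cases i <;> simp [add_comm]

theorem edgeReflection_eq_self {i : Fin 3} {d : Plane} (h : slope Q i d = 0) :
    edgeReflection Q i d = d := by
  refine Submodule.reflection_mem_subspace_eq_self (Submodule.mem_span_singleton.2
    ⟨slope Q (i + 2) d, ?_⟩)
  have := eq_slope_smul_add Q (i + 1) d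
  have e1 : i + 1 + 1 = i + 2 := by fin_cases i <;> rfl
  have e2 : i + 1 + 2 = i := by fin_cases i <;> rfl
  rw [e1, e2, h, zero_smul, add_zero] at this
  exact this.symm

theorem edgeReflection_edgeReflection (i : Fin 3) (d : Plane) :
    edgeReflection Q i (edgeReflection Q i d) = d :=
  Submodule.reflection_reflection _ d

end TriangleBilliard

/-! ### Tangency and time reversal -/

namespace BilliardTrajectory

open TriangleBilliard

variable {Q : Affine.Triangle ℝ Plane} {P R : Plane} (T : BilliardTrajectory Q P R)

theorem time_mono {i j : ℕ} (hij : i ≤ j) (hj : j ≤ T.bounces + 1) : T.time i ≤ T.time j := by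
  induction j, hij using Nat.le_induction with
  | base => rfl
  | succ j _ ih => exact (ih (by omega)).trans (T.time_lt j (by omega)).le

theorem pos_time_succ {i : ℕ} (hi : i ≤ T.bounces) :
    T.pos (T.time (i + 1)) = T.pos (T.time i) + (T.time (i + 1) - T.time i) • T.dir i :=
  T.pos_eq i hi _ ⟨(T.time_lt i hi).le, le_rfl⟩

theorem pos_time_mem {i : ℕ} (hi : i ≤ T.bounces + 1) : T.pos (T.time i) ∈ table Q :=
  T.pos_mem _ ⟨T.time_zero ▸ T.time_mono (Nat.zero_le i) hi, T.time_mono hi le_rfl⟩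

theorem dir_ne_zero {i : ℕ} (hi : i ≤ T.bounces) : T.dir i ≠ 0 := by
  rw [← norm_ne_zero_iff, T.norm_dir i hi]; exact one_ne_zero

theorem pos_time_zero : T.pos (T.time 0) = P := by rw [T.time_zero, T.pos_start]

theorem bary_pos_succ {i : ℕ} (hi : i ≤ T.bounces) (j : Fin 3) :
    bary Q j (T.pos (T.time (i + 1))) =
      bary Q j (T.pos (T.time i)) + (T.time (i + 1) - T.time i) * slope Q j (T.dir i) := by
  rw [T.pos_time_succ hi, bary_add_smul]

/-- A trajectory starting along an edge stays on it with constant velocity. -/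
theorem dir_eq_of_start_along {e : Fin 3} (hP : bary Q e P = 0) (hd : slope Q e (T.dir 0) = 0)
    {i : ℕ} (hi : i ≤ T.bounces) :
    T.dir i = T.dir 0 ∧ bary Q e (T.pos (T.time i)) = 0 ∧
      T.pos (T.time i) = P + T.time i • T.dir 0 := by
  induction i with
  | zero => exact ⟨rfl, by rw [T.pos_time_zero, hP], by rw [T.pos_time_zero, T.time_zero]; simp⟩
  | succ i ih =>
    obtain ⟨h1, h2, h3⟩ := ih (by omega)
    have hb : bary Q e (T.pos (T.time (i + 1))) = 0 := by
      rw [T.bary_pos_succ (by omega), h2, h1, hd]; ring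
    have hw : e = T.wall i := (bary_of_mem_openEdge Q (T.hit i (by omega)) e).1 hb
    refine ⟨?_, hb, ?_⟩
    · rw [T.reflect i (by omega), ← hw, h1, edgeReflection_eq_self Q hd]
    · rw [T.pos_time_succ (by omega), h1, h3]; module

/-- A closed trajectory does not start along an edge. -/
theorem slope_dir_zero_ne_zero (T : BilliardTrajectory Q P P) {e : Fin 3} (hP : bary Q e P = 0) :
    slope Q e (T.dir 0) ≠ 0 := by
  intro hd
  obtain ⟨h1, -, h3⟩ := T.dir_eq_of_start_along hP hd le_rfl
  have h4 := T.pos_time_succ le_rfl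
  rw [T.pos_end, h1, h3] at h4
  have h5 : T.time (T.bounces + 1) • T.dir 0 = 0 := by
    have : P = P + T.time (T.bounces + 1) • T.dir 0 := by
      conv_lhs => rw [h4]
      module
    simpa using this
  have h6 : 0 < T.time (T.bounces + 1) := by
    have := T.time_mono (Nat.zero_le T.bounces) (by omega)
    have := T.time_lt T.bounces le_rfl
    rw [T.time_zero] at *
    linarith
  rcases smul_eq_zero.1 h5 with h | h
  · exact h6.ne' h
  · exact T.dir_ne_zero (Nat.zero_le _) h

/-- If a trajectory does not start along an edge, it never hits an edge tangentially. -/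
theorem slope_wall_ne_zero (h0 : ∀ e, bary Q e P = 0 → slope Q e (T.dir 0) ≠ 0)
    {i : ℕ} (hi : i < T.bounces) : slope Q (T.wall i) (T.dir i) ≠ 0 := by
  induction i with
  | zero =>
    intro h
    have h1 := T.bary_pos_succ hi.le (T.wall 0)
    rw [bary_wall Q (T.hit 0 hi), h, T.pos_time_zero] at h1
    exact h0 _ (by linarith) h
  | succ i ih =>
    intro h
    have h1 := T.bary_pos_succ hi.le (T.wall (i + 1))
    rw [bary_wall Q (T.hit _ hi), h] at h1
    -- A tangential segment stays on its line, so it began on the same wall; reflection there fixes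
    -- the velocity, so the previous hit was tangential too.
    have hw : T.wall (i + 1) = T.wall i :=
      (bary_of_mem_openEdge Q (T.hit i (by omega)) _).1 (by linarith)
    rw [hw] at h
    have h2 := edgeReflection_eq_self Q h
    rw [T.reflect i (by omega), edgeReflection_edgeReflection] at h2
    rw [T.reflect i (by omega), ← h2] at h
    exact ih (by omega) h

/-- A closed trajectory that arrives in the direction opposite to the one in which it left
coincides with its reversal. -/
theorem eq_reverse (T : BilliardTrajectory Q P P)
    (h0 : ∀ e, bary Q e P = 0 → slope Q e (T.dir 0) ≠ 0)
    (hend : T.dir T.bounces = -T.dir 0) {i j : ℕ} (hij : i + j = T.bounces) :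
    T.pos (T.time i) = T.pos (T.time (j + 1)) ∧ T.dir j = -T.dir i := by
  induction i generalizing j with
  | zero =>
    obtain rfl : j = T.bounces := by omega
    exact ⟨by rw [T.pos_time_zero, T.pos_end], hend⟩
  | succ i ih =>
    obtain ⟨h1, h2⟩ := ih (j := j + 1) (by omega)
    have hi : i < T.bounces := by omega
    have hj : j < T.bounces := by omega
    have hti := T.time_lt i hi.le
    have htj := T.time_lt (j + 1) hj
    have b1 := T.bary_pos_succ hi.le
    have b2 := T.bary_pos_succ (i := j + 1) hj
    simp only [h2, ← h1, map_neg] at b2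
    have n1 := T.slope_wall_ne_zero h0 hi
    have n2 : slope Q (T.wall j) (T.dir i) ≠ 0 := by
      intro h
      have h' : slope Q (T.wall j) (T.dir (j + 1)) = 0 := by rw [h2, map_neg, h, neg_zero]
      have h3 := edgeReflection_eq_self Q h'
      rw [T.reflect j hj, edgeReflection_edgeReflection] at h3
      rw [T.reflect j hj, ← h3] at h'
      exact T.slope_wall_ne_zero h0 hj h'
    have w1 := bary_wall Q (T.hit i hi)
    have w2 := bary_wall Q (T.hit j hj)
    have m0 := bary_nonneg Q (T.pos_time_mem (i := i) (by omega))
    have m1 := bary_nonneg Q (T.pos_time_mem (i := i + 1) (by omega))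
    have m2 := bary_nonneg Q (T.pos_time_mem (i := j + 1) (by omega))
    -- Segment `i` and the reversed segment `j + 1` leave one point in the same direction. The
    -- longer one would cross transversally the wall where the shorter one ends, leaving the table.
    have hlen : T.time (i + 1) - T.time i = T.time (j + 2) - T.time (j + 1) := by
      rcases lt_trichotomy (T.time (i + 1) - T.time i) (T.time (j + 2) - T.time (j + 1))
        with h | h | h
      · exfalso
        have c1 := b1 (T.wall i)
        have c2 := b2 (T.wall i)
        have d0 := m0 (T.wall i)
        have d2 := m2 (T.wall i)
        rw [w1] at c1
        rcases lt_or_gt_of_ne n1 with g | g <;> nlinarith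
      · exact h
      · exfalso
        have c1 := b1 (T.wall j)
        have c2 := b2 (T.wall j)
        have d0 := m0 (T.wall j)
        have d1 := m1 (T.wall j)
        rw [w2] at c2
        rcases lt_or_gt_of_ne n2 with g | g <;> nlinarith
    have hpos : T.pos (T.time (i + 1)) = T.pos (T.time (j + 1)) := by
      have p2 := T.pos_time_succ (i := j + 1) hj
      rw [T.pos_time_succ hi.le, hlen, h1, p2, h2]
      module
    have hw : T.wall j = T.wall i := by
      refine (bary_of_mem_openEdge Q (T.hit i hi) _).1 ?_
      rw [hpos, w2]
    refine ⟨hpos, ?_⟩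
    have h3 : T.dir j = edgeReflection Q (T.wall j) (T.dir (j + 1)) := by
      rw [T.reflect j hj, edgeReflection_edgeReflection]
    rw [h3, h2, map_neg, hw, T.reflect i hi]

end BilliardTrajectory

/-! ### Invariance of the `n`-th power, and the contradiction -/

open TriangleBilliard

/-- In coordinates where all edges have real `n`-th powers, each bounce conjugates the `n`-th power
of the velocity. -/
theorem BilliardTrajectory.dir_pow_eq {Q : Affine.Triangle ℝ Plane} {P R : Plane}
    (T : BilliardTrajectory Q P R) (L : Plane ≃ₗᵢ[ℝ] ℂ) {n : ℕ}
    (hL : ∀ i, conj ((L (Q.points (i + 2) - Q.points (i + 1))) ^ n) =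
      (L (Q.points (i + 2) - Q.points (i + 1))) ^ n) {i : ℕ} (hi : i ≤ T.bounces) :
    (L (T.dir i)) ^ n = (L (T.dir 0)) ^ n ∨ (L (T.dir i)) ^ n = conj ((L (T.dir 0)) ^ n) := by
  induction i with
  | zero => exact Or.inl rfl
  | succ i ih =>
    have hne : Q.points (T.wall i + 2) - Q.points (T.wall i + 1) ≠ 0 :=
      sub_ne_zero.2 (Q.independent.injective.ne (by simp))
    have h1 : (L (T.dir (i + 1))) ^ n = conj ((L (T.dir i)) ^ n) := by
      rw [T.reflect i (by omega)]
      exact isometry_complex_reflection_pow L hne (hL _) _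
    rcases ih (by omega) with h | h
    · right; rw [h1, h]
    · left; rw [h1, h, Complex.conj_conj]

/-- If a triangle has angles `π / n` at its vertex `0` and `m * π / n` at its vertex `1`, there are
isometric complex coordinates in which the sides at vertex `0` have arguments `0` and `π / n`, and
all sides have real `n`-th powers. -/
theorem exists_isometry_complex_of_triangle (Q : Affine.Triangle ℝ Plane) {n m : ℕ} (hn0 : n ≠ 0)
    (hn : Even n)
    (hA : EuclideanGeometry.angle (Q.points 1) (Q.points 0) (Q.points 2) = Real.pi / n)
    (hB : EuclideanGeometry.angle (Q.points 0) (Q.points 1) (Q.points 2) = m * Real.pi / n) :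
    ∃ L : Plane ≃ₗᵢ[ℝ] ℂ, L (Q.points 1 - Q.points 0) = ‖Q.points 1 - Q.points 0‖ ∧
      L (Q.points 2 - Q.points 0) =
        ‖Q.points 2 - Q.points 0‖ * Complex.exp ((Real.pi / n : ℝ) * Complex.I) ∧
      ∀ i, conj ((L (Q.points (i + 2) - Q.points (i + 1))) ^ n) =
        (L (Q.points (i + 2) - Q.points (i + 1))) ^ n := by
  have hne {i j : Fin 3} (h : i ≠ j) : Q.points i - Q.points j ≠ 0 :=
    sub_ne_zero.2 (Q.independent.injective.ne h)
  obtain ⟨L, hu, hw⟩ := exists_isometry_complex_of_angle (hne (i := 1) (j := 0) (by decide))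
    (hne (i := 2) (j := 0) (by decide))
  have hLne {i j : Fin 3} (h : i ≠ j) : L (Q.points i - Q.points j) ≠ 0 := by
    simpa only [ne_eq, EmbeddingLike.map_eq_zero_iff] using hne h
  have hA' : InnerProductGeometry.angle (Q.points 1 - Q.points 0) (Q.points 2 - Q.points 0)
      = Real.pi / n := hA
  have hB' : InnerProductGeometry.angle (Q.points 0 - Q.points 1) (Q.points 2 - Q.points 1)
      = m * Real.pi / n := hB
  have hLang (x y : Plane) : InnerProductGeometry.angle (L x) (L y)
      = InnerProductGeometry.angle x y := L.toLinearIsometry.angle_map x y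
  -- Evenness of `n` makes the orientation of a side irrelevant.
  have hneg (i j : Fin 3) : (L (Q.points i - Q.points j)) ^ n
      = (L (Q.points j - Q.points i)) ^ n := by
    rw [← neg_sub, map_neg, hn.neg_pow]
  have h10 : conj ((L (Q.points 1 - Q.points 0)) ^ n) = (L (Q.points 1 - Q.points 0)) ^ n := by
    rw [hu, map_pow, Complex.conj_ofReal]
  have h20 : conj ((L (Q.points 2 - Q.points 0)) ^ n) = (L (Q.points 2 - Q.points 0)) ^ n := by
    refine Complex.conj_pow_of_angle (k := 1) (hLne (by decide)) (hLne (by decide)) hn0 ?_ h10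
    rw [hLang, hA', Nat.cast_one, one_mul]
  have h21 : conj ((L (Q.points 2 - Q.points 1)) ^ n) = (L (Q.points 2 - Q.points 1)) ^ n := by
    refine Complex.conj_pow_of_angle (k := m) (hLne (i := 0) (j := 1) (by decide))
      (hLne (by decide)) hn0 ?_ ?_
    · rw [hLang, hB']
    · rw [hneg]; exact h10
  refine ⟨L, hu, by rw [hw, hA'], fun i => ?_⟩
  fin_cases i
  · exact h21
  · change conj ((L (Q.points 0 - Q.points 2)) ^ n) = (L (Q.points 0 - Q.points 2)) ^ n
    rw [hneg]; exact h20
  · exact h10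

/-- If a triangle `Q` with vertices `A = Q.points 0`, `B = Q.points 1`, `C = Q.points 2` has angle
`π / n` at `A` and angle `m π / n` at `B`, with `n` even and `0 < m < n - 1`, then there is no
billiard trajectory in `Q` from `A` to `A`. -/
theorem mainTheorem4 (Q : Affine.Triangle ℝ Plane) (n m : ℕ)
    (hn : Even n) (hm : 0 < m) (hmn : m + 1 < n)
    (hA : EuclideanGeometry.angle (Q.points 1) (Q.points 0) (Q.points 2) = Real.pi / n)
    (hB : EuclideanGeometry.angle (Q.points 0) (Q.points 1) (Q.points 2) = m * Real.pi / n) :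
    IsEmpty (BilliardTrajectory Q (Q.points 0) (Q.points 0)) := by
  refine ⟨fun T => ?_⟩
  have hn0 : n ≠ 0 := by omega
  have hnpos : (0 : ℝ) < n := by positivity
  obtain ⟨L, hu, hw, hL⟩ := exists_isometry_complex_of_triangle Q hn0 hn hA hB
  have hα : 0 < Real.pi / n := by positivity
  have hα' : Real.pi / n < Real.pi :=
    div_lt_self Real.pi_pos (by exact_mod_cast (by omega : 1 < n))
  have hnα : n * (Real.pi / n) = Real.pi := by field_simp
  have hside (i : Fin 3) (hi : i ≠ 0) : 0 < ‖Q.points i - Q.points 0‖ :=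
    norm_pos_iff.2 (sub_ne_zero.2 (Q.independent.injective.ne hi))
  have hLd (d : Plane) : L d = ((slope Q 1 d * ‖Q.points 1 - Q.points 0‖ : ℝ) : ℂ) +
      ((slope Q 2 d * ‖Q.points 2 - Q.points 0‖ : ℝ) : ℂ) *
        Complex.exp ((Real.pi / n : ℝ) * Complex.I) := by
    have h := congrArg L (eq_slope_smul_add Q 0 d)
    rw [map_add, map_smul, map_smul] at h
    simp only [zero_add] at h
    rw [hu, hw, Complex.real_smul, Complex.real_smul, ← mul_assoc] at h
    push_cast at h ⊢
    exact h
  have hA0 (e : Fin 3) : bary Q e (Q.points 0) = 0 ↔ e ≠ 0 := by simp [bary_points]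
  have h0 : ∀ e, bary Q e (Q.points 0) = 0 → slope Q e (T.dir 0) ≠ 0 :=
    fun e he => T.slope_dir_zero_ne_zero he
  have hstart (e : Fin 3) (he : e ≠ 0) : 0 < slope Q e (T.dir 0) := by
    refine lt_of_le_of_ne ?_ (h0 e ((hA0 e).2 he)).symm
    have h1 := T.bary_pos_succ (Nat.zero_le _) e
    have h2 := bary_nonneg Q (T.pos_time_mem (i := 1) (by omega)) e
    rw [T.pos_time_zero, (hA0 e).2 he, zero_add] at h1
    rw [h1, zero_add] at h2
    exact nonneg_of_mul_nonneg_right h2 (sub_pos.2 (T.time_lt 0 (Nat.zero_le _)))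
  have hfinal (e : Fin 3) (he : e ≠ 0) : 0 ≤ slope Q e (-T.dir T.bounces) := by
    have h1 := T.bary_pos_succ le_rfl e
    have h2 := bary_nonneg Q (T.pos_time_mem (i := T.bounces) (by omega)) e
    have h3 := sub_pos.2 (T.time_lt T.bounces le_rfl)
    rw [T.pos_end, (hA0 e).2 he] at h1
    rw [map_neg]
    refine nonneg_of_mul_nonneg_right (a := T.time (T.bounces + 1) - T.time T.bounces) ?_ h3
    linarith
  have hpow (d : Plane) (hd : ‖d‖ = 1) :
      (L d) ^ n = Complex.exp ((n * (L d).arg : ℝ) * Complex.I) := by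
    rw [Complex.pow_eq_norm_pow_mul_exp, L.norm_map, hd]; simp
  have hd0 := T.norm_dir 0 (Nat.zero_le _)
  have hdk : ‖-T.dir T.bounces‖ = 1 := by rw [norm_neg, T.norm_dir _ le_rfl]
  -- the arguments of the initial velocity and of the reversed final velocity
  have hθ : (L (T.dir 0)).arg ∈ Set.Ioo 0 (Real.pi / n) := by
    rw [hLd]
    exact (Complex.arg_mem_Ioo_of_sector hα hα'
      (mul_pos (hstart 1 (by decide)) (hside 1 (by decide)))
      (mul_pos (hstart 2 (by decide)) (hside 2 (by decide)))).2
  have hφ : (L (-T.dir T.bounces)).arg ∈ Set.Icc 0 (Real.pi / n) := by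
    have hne : L (-T.dir T.bounces) ≠ 0 := by
      rw [← norm_ne_zero_iff, L.norm_map, hdk]; exact one_ne_zero
    rw [hLd] at hne ⊢
    exact Complex.arg_mem_Icc_of_sector hα hα'
      (mul_nonneg (hfinal 1 (by decide)) (hside 1 (by decide)).le)
      (mul_nonneg (hfinal 2 (by decide)) (hside 2 (by decide)).le) hne
  have hnθ : n * (L (T.dir 0)).arg < Real.pi := by
    rw [← hnα]; exact mul_lt_mul_of_pos_left hθ.2 hnpos
  have hnφ : n * (L (-T.dir T.bounces)).arg ≤ Real.pi := by
    rw [← hnα]; exact mul_le_mul_of_nonneg_left hφ.2 hnpos.le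
  have hz0 : conj ((L (T.dir 0)) ^ n) ≠ (L (T.dir 0)) ^ n := by
    rw [Ne, Complex.conj_eq_iff_im, hpow _ hd0, Complex.exp_ofReal_mul_I_im]
    exact (Real.sin_pos_of_pos_of_lt_pi (mul_pos hnpos hθ.1) hnθ).ne'
  have hre : ((L (-T.dir T.bounces)) ^ n).re = ((L (T.dir 0)) ^ n).re := by
    rw [map_neg, hn.neg_pow]
    rcases T.dir_pow_eq L hL le_rfl with h | h <;> rw [h]
    rw [Complex.conj_re]
  have hend : T.dir T.bounces = -T.dir 0 := by
    rw [hpow _ hd0, hpow _ hdk, Complex.exp_ofReal_mul_I_re, Complex.exp_ofReal_mul_I_re] at hre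
    have h1 := Real.injOn_cos ⟨mul_nonneg hnpos.le hφ.1, hnφ⟩
      ⟨mul_nonneg hnpos.le hθ.1.le, hnθ.le⟩ hre
    have h2 := mul_left_cancel₀ hnpos.ne' h1
    have h3 : L (-T.dir T.bounces) = L (T.dir 0) :=
      Complex.ext_norm_arg (by rw [L.norm_map, L.norm_map, hdk, hd0]) h2
    rw [← L.injective h3, neg_neg]
  -- The middle of the self-reversed path is a segment for an even number of bounces, a bounce for
  -- an odd number.
  rcases Nat.even_or_odd' T.bounces with ⟨j, hj | hj⟩
  · have h := (T.eq_reverse h0 hend (i := j) (j := j) (by omega)).2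
    have h2 : (2 : ℝ) • T.dir j = 0 := by
      rw [two_smul]; exact eq_neg_iff_add_eq_zero.1 h
    exact T.dir_ne_zero (i := j) (by omega) ((smul_eq_zero.1 h2).resolve_left two_ne_zero)
  · have h := (T.eq_reverse h0 hend (i := j) (j := j + 1) (by omega)).2
    have hne : Q.points (T.wall j + 2) - Q.points (T.wall j + 1) ≠ 0 :=
      sub_ne_zero.2 (Q.independent.injective.ne (by simp))
    have h1 := isometry_complex_reflection_pow L hne (hL _) (T.dir j)
    have h2 : (L (T.dir (j + 1))) ^ n = conj ((L (T.dir j)) ^ n) := by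
      rw [T.reflect j (by omega)]; exact h1
    rw [h, map_neg, hn.neg_pow] at h2
    rcases T.dir_pow_eq L hL (i := j) (by omega) with h3 | h3 <;> rw [h3] at h2
    · exact hz0 h2.symm
    · rw [Complex.conj_conj] at h2
      exact hz0 h2
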